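/- Let $\alpha\in\mathbb{R}$, let $U\subseteq\mathbb{R}$ be open, and let $G$ be analytic on the half-plane $\Re e\, s>\alpha$. Conventions. The Fourier transform is $\hat\varphi(t)=\int_{-\infty}^{\infty}e^{-itx}\varphi(x)\,\mathrm{d}x$, extended to tempered distributions by $\langle\hat f,\varphi\rangle=\langle f,\hat\varphi\rangle$ for $\varphi\in\mathcal{S}(\mathbb{R})$. A tempered distribution $f\in\mathcal{S}'(\mathbb{R})$ is a pseudomeasure if $\hat f\in L^\infty(\mathbb{R})$, and a pseudofunction if in addition $\lim_{|x|\to\infty}\hat f(x)=0$ (for a suitable representative of $\hat f$). A distribution $g\in\mathcal{D}'(U)$ is a local pseudomeasure (local pseudofunction) on $U$ if every point of $U$ has an open neighborhood on which $g$ coincides with a pseudomeasure (pseudofunction). The function $G$ has local pseudomeasure (local pseudofunction) boundary behavior on $\alpha+iU$ if there is a local pseudomeasure (local pseudofunction) $g$ on $U$ such that $$\lim_{\sigma\to\alpha^+}\int_{-\infty}^{\infty}G(\sigma+it)\varphi(t)\,\mathrm{d}t=\langle g,\varphi\rangle\qquad\text{for every }\varphi\in\mathcal{D}(U).$$ Let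 $A_c(\mathbb{R})$ be the set of compactly supported functions of the form $\varphi=\hat\psi$ with $\psi\in L^1(\mathbb{R})$. For $\varphi\in A_c(\mathbb{R})$, the function $G$ has pseudomeasure (pseudofunction) boundary behavior on $\Re e\, s=\alpha$ with respect to $\varphi$ if there is $N>0$ such that the limit $$I_\varphi(h)=\lim_{\sigma\to\alpha^+}\int_{-\infty}^{\infty}G(\sigma+it)e^{iht}\varphi(t)\,\mathrm{d}t$$ exists for every $h\ge N$, and $I_\varphi(h)=O(1)$ (respectively $I_\varphi(h)=o(1)$) as $h\to\infty$. Proposition. If $G$ has local pseudomeasure (respectively local pseudofunction) boundary behavior on $\alpha+iU$, then $G$ has pseudomeasure (respectively pseudofunction) boundary behavior on $\Re e\, s=\alpha$ with respect to every $\varphi\in A_c(\mathbb{R})$ with $\operatorname{supp}\varphi\subset U$. -/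

import Mathlib

open Complex MeasureTheory Filter Topology TopologicalSpace Asymptotics
open scoped SchwartzMap Distributions FourierTransform ENNReal

noncomputable section

namespace BoundaryBehavior

/-! ### Fourier transform with the normalization `φ̂(t) = ∫ e^{-itx} φ(x) dx` -/

/-- The continuous linear equivalence `t ↦ t / (2π)` of the real line. -/
def scaling : ℝ ≃L[ℝ] ℝ :=
  ContinuousLinearEquiv.unitsEquivAut ℝ
    (Units.mk0 ((2 * Real.pi)⁻¹) (inv_ne_zero (mul_ne_zero two_ne_zero Real.pi_ne_zero)))

theorem scaling_apply (t : ℝ) : scaling t = t * (2 * Real.pi)⁻¹ := rfl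

/-- The Fourier transform `φ ↦ φ̂` on the Schwartz space, obtained from Mathlib's Fourier transform
(with kernel `e^{-2πitx}`) by rescaling; `schwartzFourier_apply` is the explicit formula. -/
def schwartzFourier : 𝓢(ℝ, ℂ) →L[ℂ] 𝓢(ℝ, ℂ) :=
  (SchwartzMap.compCLMOfContinuousLinearEquiv ℂ scaling).comp
    (FourierTransform.fourierCLM ℂ 𝓢(ℝ, ℂ))

theorem schwartzFourier_apply (φ : 𝓢(ℝ, ℂ)) (t : ℝ) :
    schwartzFourier φ t = ∫ x : ℝ, Complex.exp (-(I * t * x)) * φ x := by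
  change 𝓕 (φ : ℝ → ℂ) (scaling t) = _
  rw [Real.fourier_real_eq_integral_exp_smul, scaling_apply]
  refine integral_congr_ae (Eventually.of_forall fun x => ?_)
  have hpi : (Real.pi : ℂ) ≠ 0 := by exact_mod_cast Real.pi_ne_zero
  simp only [smul_eq_mul]
  congr 2
  push_cast
  field_simp

/-- The Fourier transform on tempered distributions, `⟨f̂, φ⟩ = ⟨f, φ̂⟩`. -/
def temperedFourier (f : 𝓢'(ℝ, ℂ)) : 𝓢'(ℝ, ℂ) :=
  PointwiseConvergenceCLM.precomp ℂ schwartzFourier f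

theorem temperedFourier_apply (f : 𝓢'(ℝ, ℂ)) (φ : 𝓢(ℝ, ℂ)) :
    temperedFourier f φ = f (schwartzFourier φ) := rfl

/-! ### Global and local pseudomeasures and pseudofunctions -/

/-- A tempered distribution `f` is a (global) pseudomeasure if `f̂ ∈ L^∞(ℝ)`. -/
def IsPseudomeasure (f : 𝓢'(ℝ, ℂ)) : Prop :=
  ∃ F : ℝ → ℂ, MemLp F ∞ volume ∧
    ∀ φ : 𝓢(ℝ, ℂ), temperedFourier f φ = ∫ x : ℝ, F x * φ x

/-- A tempered distribution `f` is a (global) pseudofunction if `f̂ ∈ L^∞(ℝ)` and `f̂(x) → 0` as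
`|x| → ∞` (for a suitable representative of the class `f̂`). -/
def IsPseudofunction (f : 𝓢'(ℝ, ℂ)) : Prop :=
  ∃ F : ℝ → ℂ, MemLp F ∞ volume ∧ Tendsto F (cocompact ℝ) (𝓝 0) ∧
    ∀ φ : 𝓢(ℝ, ℂ), temperedFourier f φ = ∫ x : ℝ, F x * φ x

/-- A distribution `g ∈ 𝓓'(U)` coincides with the tempered distribution `f` on `V`: they agree on
the test functions supported in `V` (used for open `V ⊆ U`). -/
def CoincidesOn {U : Opens ℝ} (g : 𝓓(U, ℂ) →L[ℂ] ℂ) (f : 𝓢'(ℝ, ℂ)) (V : Opens ℝ) : Prop :=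
  ∀ φ : 𝓓(U, ℂ), tsupport φ ⊆ (V : Set ℝ) →
    g φ = f (φ.hasCompactSupport.toSchwartzMap φ.contDiff)

/-- `g ∈ PM_loc(U)`: each point of `U` has an open neighbourhood on which `g ∈ 𝓓'(U)` coincides
with a pseudomeasure. -/
def IsLocalPseudomeasure {U : Opens ℝ} (g : 𝓓(U, ℂ) →L[ℂ] ℂ) : Prop :=
  ∀ t₀ ∈ U, ∃ V : Opens ℝ, t₀ ∈ V ∧ V ≤ U ∧ ∃ f : 𝓢'(ℝ, ℂ), IsPseudomeasure f ∧ CoincidesOn g f V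

/-- `g ∈ PF_loc(U)`: each point of `U` has an open neighbourhood on which `g ∈ 𝓓'(U)` coincides
with a pseudofunction. -/
def IsLocalPseudofunction {U : Opens ℝ} (g : 𝓓(U, ℂ) →L[ℂ] ℂ) : Prop :=
  ∀ t₀ ∈ U, ∃ V : Opens ℝ, t₀ ∈ V ∧ V ≤ U ∧ ∃ f : 𝓢'(ℝ, ℂ), IsPseudofunction f ∧ CoincidesOn g f V

/-! ### Local boundary behaviour -/

/-- `g ∈ 𝓓'(U)` is the boundary distribution of `G` on `α + iU`. -/
def HasBoundaryDistribution (G : ℂ → ℂ) (α : ℝ) {U : Opens ℝ} (g : 𝓓(U, ℂ) →L[ℂ] ℂ) : Prop :=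
  ∀ φ : 𝓓(U, ℂ),
    Tendsto (fun σ : ℝ => ∫ t : ℝ, G (σ + I * t) * φ t) (𝓝[>] α) (𝓝 (g φ))

/-- Local pseudomeasure boundary behaviour of `G` on `α + iU`. -/
def HasLocalPseudomeasureBoundary (G : ℂ → ℂ) (α : ℝ) (U : Opens ℝ) : Prop :=
  ∃ g : 𝓓(U, ℂ) →L[ℂ] ℂ, IsLocalPseudomeasure g ∧ HasBoundaryDistribution G α g

/-- Local pseudofunction boundary behaviour of `G` on `α + iU`. -/
def HasLocalPseudofunctionBoundary (G : ℂ → ℂ) (α : ℝ) (U : Opens ℝ) : Prop :=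
  ∃ g : 𝓓(U, ℂ) →L[ℂ] ℂ, IsLocalPseudofunction g ∧ HasBoundaryDistribution G α g

/-! ### Boundary behaviour with respect to a function of the Wiener algebra -/

/-- The Wiener algebra `A(ℝ) = 𝓕(L¹(ℝ))`. -/
def wienerAlgebra : Set (ℝ → ℂ) :=
  {φ | ∃ ψ : ℝ → ℂ, Integrable ψ ∧ ∀ t : ℝ, φ t = ∫ x : ℝ, Complex.exp (-(I * t * x)) * ψ x}

/-- The compactly supported elements `A_c(ℝ)` of the Wiener algebra. -/
def wienerAlgebraCompact : Set (ℝ → ℂ) :=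
  {φ | φ ∈ wienerAlgebra ∧ HasCompactSupport φ}

/-- `J` is the limit `I_φ(h) = lim_{σ → α⁺} ∫ G(σ + it) e^{iht} φ(t) dt`. -/
def IsBoundaryLimit (G : ℂ → ℂ) (α : ℝ) (φ : ℝ → ℂ) (h : ℝ) (J : ℂ) : Prop :=
  Tendsto (fun σ : ℝ => ∫ t : ℝ, G (σ + I * t) * Complex.exp (I * h * t) * φ t) (𝓝[>] α) (𝓝 J)

/-- Pseudomeasure boundary behaviour of `G` on `Re s = α` with respect to `φ`: the limit `I_φ(h)`
exists for all `h ≥ N`, for some `N > 0`, and `I_φ(h) = O(1)` as `h → ∞`. -/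
def HasPseudomeasureBoundaryWrt (G : ℂ → ℂ) (α : ℝ) (φ : ℝ → ℂ) : Prop :=
  ∃ N : ℝ, 0 < N ∧ ∃ Iφ : ℝ → ℂ,
    (∀ h : ℝ, N ≤ h → IsBoundaryLimit G α φ h (Iφ h)) ∧ Iφ =O[atTop] (fun _ : ℝ => (1 : ℝ))

/-- Pseudofunction boundary behaviour of `G` on `Re s = α` with respect to `φ`: the limit `I_φ(h)`
exists for all `h ≥ N`, for some `N > 0`, and `I_φ(h) = o(1)` as `h → ∞`. -/
def HasPseudofunctionBoundaryWrt (G : ℂ → ℂ) (α : ℝ) (φ : ℝ → ℂ) : Prop :=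
  ∃ N : ℝ, 0 < N ∧ ∃ Iφ : ℝ → ℂ,
    (∀ h : ℝ, N ≤ h → IsBoundaryLimit G α φ h (Iφ h)) ∧ Iφ =o[atTop] (fun _ : ℝ => (1 : ℝ))

end BoundaryBehavior

end

/-! Write `φ = ψ̂` with `ψ` integrable, and take a smooth cutoff `χ` supported in `U` and equal to 1
on the support of `φ`. With `L_σ = lineFourier G χ σ`, Fubini turns `∫ G(σ+it) e^{iht} φ(t) dt` into
`∫ ψ(y) L_σ(y - h) dy` (`integral_line_mul_fourier`). As `σ → α⁺`, `L_σ` converges pointwise to some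
`ℓ`. A partition of unity reduces to the case where the boundary distribution is a global object
with transform `F`; there `ℓ` averages translates of `F` against a Schwartz function. Hence `ℓ` is
bounded, and in the pseudofunction case it vanishes at `-∞`. Both conclusions follow from `I_φ(h) =
∫ ψ(y) ℓ(y - h) dy`.

The difficulty is passing to the limit under the integral: `ψ` is only integrable, so `L_σ(x)` must
be bounded uniformly in `σ` and `x` (`exists_uniform_bound`). Banach–Steinhaus first gives a bound
polynomial in `x` (`exists_polynomial_bound`). The Cauchy–Riemann equation gives `∂_σ L_σ = x L_σ +
i M_σ`, with `M_σ` built from `χ'`. Integrated from the end of `(α, α+1]` at which the sign of `x`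
makes it damped, this lowers the degree by one (`polynomial_bound_of_succ`); iteration reaches
degree 0. -/

namespace BoundaryBehavior

/-! ### Test functions and Fourier transforms on vertical lines -/

/-- Smooth functions with compact support contained in `U`. -/
structure IsTest (U : Set ℝ) (χ : ℝ → ℂ) : Prop where
  contDiff : ContDiff ℝ (⊤ : ℕ∞) χ
  hasCompactSupport : HasCompactSupport χ
  tsupport_subset : tsupport χ ⊆ U

/-- The Fourier transform of `t ↦ G (σ + i t) χ t` at `x`. -/
noncomputable def lineFourier (G : ℂ → ℂ) (χ : ℝ → ℂ) (σ x : ℝ) : ℂ :=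
  ∫ t : ℝ, G (σ + I * t) * (exp (-(I * x * t)) * χ t)

theorem norm_exp_neg_I_mul (x t : ℝ) : ‖exp (-(I * x * t))‖ = 1 := by
  have : -(I * (x : ℂ) * t) = ((-(x * t) : ℝ) : ℂ) * I := by push_cast; ring
  rw [this, norm_exp_ofReal_mul_I]

theorem contDiff_exp_neg_I_mul (x : ℝ) {n : WithTop ℕ∞} :
    ContDiff ℝ n fun t : ℝ => exp (-(I * x * t)) :=
  ((contDiff_const.mul ofRealCLM.contDiff).neg).cexp

namespace IsTest

variable {U : Set ℝ} {χ : ℝ → ℂ}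

theorem continuous (hχ : IsTest U χ) : Continuous χ := hχ.contDiff.continuous

theorem mono {V : Set ℝ} (hχ : IsTest U χ) (h : tsupport χ ⊆ V) : IsTest V χ :=
  ⟨hχ.contDiff, hχ.hasCompactSupport, h⟩

theorem mul_left {u : ℝ → ℂ} (hχ : IsTest U χ) (hu : ContDiff ℝ (⊤ : ℕ∞) u) :
    IsTest U fun t => u t * χ t :=
  ⟨hu.mul hχ.contDiff, hχ.hasCompactSupport.mul_left,
    (tsupport_mul_subset_right (f := u)).trans hχ.tsupport_subset⟩

theorem modulate (hχ : IsTest U χ) (x : ℝ) : IsTest U fun t => exp (-(I * x * t)) * χ t :=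
  hχ.mul_left (contDiff_exp_neg_I_mul x)

theorem deriv (hχ : IsTest U χ) : IsTest U (deriv χ) where
  contDiff := ((contDiff_infty_iff_deriv (𝕜 := ℝ)).1 hχ.contDiff).2
  hasCompactSupport := hχ.hasCompactSupport.deriv
  tsupport_subset := (closure_minimal (support_deriv_subset (f := χ)) (isClosed_tsupport _)).trans
    hχ.tsupport_subset

end IsTest

/-! ### Holomorphy and the evolution equation in `σ` -/

section HalfPlane

variable {α : ℝ} {G : ℂ → ℂ}

theorem continuousOn_line (hG : AnalyticOnNhd ℂ G {s : ℂ | α < s.re}) :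
    ContinuousOn (fun p : ℝ × ℝ => G (p.1 + I * p.2)) (Set.Ioi α ×ˢ Set.univ) :=
  hG.continuousOn.comp (by fun_prop) fun p hp => by simpa using hp.1

theorem continuous_line (hG : AnalyticOnNhd ℂ G {s : ℂ | α < s.re}) {σ : ℝ} (hσ : α < σ) :
    Continuous fun t : ℝ => G (σ + I * t) := by
  rw [← continuousOn_univ]
  exact (continuousOn_line hG).comp (f := fun t : ℝ => (σ, t)) (by fun_prop)
    fun t _ => ⟨hσ, trivial⟩

theorem integrable_line_mul (hG : AnalyticOnNhd ℂ G {s : ℂ | α < s.re}) {σ : ℝ} (hσ : α < σ)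
    {Φ : ℝ → ℂ} (hΦ : Continuous Φ) (hΦc : HasCompactSupport Φ) :
    Integrable fun t : ℝ => G (σ + I * t) * Φ t :=
  ((continuous_line hG hσ).mul hΦ).integrable_of_hasCompactSupport hΦc.mul_left

theorem hasDerivAt_integral_line (hG : AnalyticOnNhd ℂ G {s : ℂ | α < s.re}) {σ : ℝ} (hσ : α < σ)
    {Φ : ℝ → ℂ} (hΦ : Continuous Φ) (hΦc : HasCompactSupport Φ) :
    HasDerivAt (fun σ : ℝ => ∫ t : ℝ, G (σ + I * t) * Φ t)
      (∫ t : ℝ, deriv G (σ + I * t) * Φ t) σ := by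
  -- The closed `δ`-interval around `σ` stays to the right of `α`, so `G'` is bounded on a compact
  -- rectangle and gives the dominating function.
  obtain ⟨δ, hδ, hδα⟩ : ∃ δ > 0, α < σ - δ := ⟨(σ - α) / 2, by linarith, by linarith⟩
  have hK : IsCompact (Set.Icc (σ - δ) (σ + δ) ×ˢ tsupport Φ) := isCompact_Icc.prod hΦc
  obtain ⟨M, hM⟩ := hK.exists_bound_of_continuousOn
    ((continuousOn_line hG.deriv).mono (Set.prod_mono (fun s hs => hδα.trans_le hs.1)
      (Set.subset_univ _)))
  have hball : ∀ s ∈ Metric.ball σ δ, s ∈ Set.Icc (σ - δ) (σ + δ) := fun s hs => by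
    rw [Real.ball_eq_Ioo] at hs
    exact ⟨hs.1.le, hs.2.le⟩
  refine (hasDerivAt_integral_of_dominated_loc_of_deriv_le (bound := fun t => M * ‖Φ t‖)
    (F' := fun s t => deriv G (s + I * t) * Φ t)
    (Metric.ball_mem_nhds σ hδ) ?_ (integrable_line_mul hG hσ hΦ hΦc)
    (integrable_line_mul hG.deriv hσ hΦ hΦc).aestronglyMeasurable ?_ ?_ ?_).2
  · filter_upwards [lt_mem_nhds hσ] with s hs
    exact (integrable_line_mul hG hs hΦ hΦc).aestronglyMeasurable
  · refine Eventually.of_forall fun t s hs => ?_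
    by_cases ht : t ∈ tsupport Φ
    · rw [norm_mul]
      gcongr
      exact hM (s, t) ⟨hball s hs, ht⟩
    · simp [image_eq_zero_of_notMem_tsupport ht]
  · exact (hΦ.norm.integrable_of_hasCompactSupport hΦc.norm).const_mul M
  · refine Eventually.of_forall fun t s hs => ?_
    have hs' : α < ((s : ℂ) + I * t).re := by simpa using hδα.trans_le (hball s hs).1
    have h1 : HasDerivAt (fun s : ℝ => (s : ℂ) + I * t) 1 s :=
      (hasDerivAt_id s).ofReal_comp.add_const _
    have h2 := HasDerivAt.comp s (hG _ hs').differentiableAt.hasDerivAt h1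
    simpa using h2.mul_const (Φ t)

/-- By holomorphy `∂_t G(σ+it) = i G'(σ+it)`; integration by parts moves this derivative onto the
test function. -/
theorem integral_deriv_line (hG : AnalyticOnNhd ℂ G {s : ℂ | α < s.re}) {σ : ℝ} (hσ : α < σ)
    {U : Set ℝ} {Φ : ℝ → ℂ} (hΦ : IsTest U Φ) :
    ∫ t : ℝ, deriv G (σ + I * t) * Φ t = I * ∫ t : ℝ, G (σ + I * t) * deriv Φ t := by
  have hd : ∀ t : ℝ, HasDerivAt (fun t : ℝ => G (σ + I * t)) (I * deriv G (σ + I * t)) t := by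
    intro t
    have hs' : α < ((σ : ℂ) + I * t).re := by simpa using hσ
    have h1 : HasDerivAt (fun t : ℝ => (σ : ℂ) + I * t) (I * 1) t :=
      ((hasDerivAt_id t).ofReal_comp.const_mul I).const_add _
    have h2 := HasDerivAt.comp t (hG _ hs').differentiableAt.hasDerivAt h1
    exact h2.congr_deriv (by ring)
  have hi := integrable_line_mul hG.deriv hσ hΦ.continuous hΦ.hasCompactSupport
  have key := integral_mul_deriv_eq_deriv_mul_of_integrable (u := fun t : ℝ => G (σ + I * t))
    (v := Φ) (fun t _ => hd t)
    (fun t _ => (hΦ.contDiff.differentiable (by simp) t).hasDerivAt)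
    (integrable_line_mul hG hσ hΦ.deriv.continuous hΦ.deriv.hasCompactSupport)
    ((hi.const_mul I).congr (Eventually.of_forall fun t => (mul_assoc _ _ _).symm))
    (integrable_line_mul hG hσ hΦ.continuous hΦ.hasCompactSupport)
  rw [key]
  simp only [mul_assoc, integral_const_mul]
  rw [mul_neg, ← mul_assoc, I_mul_I]
  ring

/-- Differentiating `e^{-ixt} χ` produces `-ix`, which the factor `i` turns into the real
coefficient `x`. The inhomogeneous term is of the same kind, with `χ'` for `χ`, so bounds valid for
all test functions control it. -/
theorem hasDerivAt_lineFourier (hG : AnalyticOnNhd ℂ G {s : ℂ | α < s.re}) {σ : ℝ} (hσ : α < σ)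
    {U : Set ℝ} {χ : ℝ → ℂ} (hχ : IsTest U χ) (x : ℝ) :
    HasDerivAt (fun σ => lineFourier G χ σ x)
      (x * lineFourier G χ σ x + I * lineFourier G (deriv χ) σ x) σ := by
  have hm := hχ.modulate x
  have hm' := hχ.deriv.modulate x
  have h := hasDerivAt_integral_line hG hσ hm.continuous hm.hasCompactSupport
  rw [integral_deriv_line hG hσ hm] at h
  refine HasDerivAt.congr_deriv (f := fun σ => lineFourier G χ σ x) h ?_
  have hd : ∀ t : ℝ, deriv (fun t : ℝ => exp (-(I * x * t)) * χ t) t =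
      -(I * x) * (exp (-(I * x * t)) * χ t) + exp (-(I * x * t)) * deriv χ t := by
    intro t
    have h1 : HasDerivAt (fun t : ℝ => -(I * x * (t : ℂ))) (-(I * x * 1)) t :=
      ((hasDerivAt_id t).ofReal_comp.const_mul _).neg
    have h2 := h1.cexp.mul (hχ.contDiff.differentiable (by simp) t).hasDerivAt
    refine HasDerivAt.deriv (h2.congr_deriv ?_)
    ring
  have hsum : ∀ t : ℝ, G (σ + I * t) * deriv (fun t : ℝ => exp (-(I * x * t)) * χ t) t =
      -(I * x) * (G (σ + I * t) * (exp (-(I * x * t)) * χ t)) +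
        G (σ + I * t) * (exp (-(I * x * t)) * deriv χ t) := by
    intro t; rw [hd]; ring
  rw [integral_congr_ae (Eventually.of_forall hsum)]
  rw [integral_add ((integrable_line_mul hG hσ hm.continuous hm.hasCompactSupport).const_mul _)
    (integrable_line_mul hG hσ hm'.continuous hm'.hasCompactSupport), integral_const_mul]
  simp only [lineFourier]
  linear_combination -(x * ∫ t : ℝ, G (σ + I * t) * (exp (-(I * x * t)) * χ t)) * I_mul_I

end HalfPlane

/-! ### Damped linear differential equations -/

/-- A solution of `f' = -k f + r` with `k > 0` and `‖r‖ ≤ R` grows by at most `R / k`. -/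
theorem norm_le_of_hasDerivAt_neg {f r : ℝ → ℂ} {a b k R : ℝ} (hk : 0 < k) (hab : a ≤ b)
    (hR : 0 ≤ R) (hf : ∀ s ∈ Set.Icc a b, HasDerivAt f (-k * f s + r s) s)
    (hr : ∀ s ∈ Set.Icc a b, ‖r s‖ ≤ R) : ‖f b‖ ≤ ‖f a‖ + R / k := by
  have hexp : ∀ s : ℝ, HasDerivAt (fun s : ℝ => Real.exp (k * (s - a)))
      (k * Real.exp (k * (s - a))) s := fun s => by
    have h1 : HasDerivAt (fun s : ℝ => k * (s - a)) (k * 1) s :=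
      ((hasDerivAt_id s).sub_const a).const_mul k
    exact h1.exp.congr_deriv (by ring)
  have hg : ∀ s ∈ Set.Icc a b, HasDerivAt (fun s : ℝ => (Real.exp (k * (s - a)) : ℂ) * f s)
      (Real.exp (k * (s - a)) * r s) s := fun s hs => by
    refine ((hexp s).ofReal_comp.mul (hf s hs)).congr_deriv ?_
    push_cast; ring
  -- The integrating factor `e^{k(s-a)}` leaves a derivative of norm at most `R e^{k(s-a)}`, which
  -- is the derivative of the majorant `B`.
  have key := image_norm_le_of_norm_deriv_right_le_deriv_boundary
    (f := fun s : ℝ => (Real.exp (k * (s - a)) : ℂ) * f s)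
    (B := fun s => ‖f a‖ + R / k * (Real.exp (k * (s - a)) - 1))
    (B' := fun s => R / k * (k * Real.exp (k * (s - a))))
    (fun s hs => (hg s hs).continuousAt.continuousWithinAt)
    (fun s hs => (hg s ⟨hs.1, hs.2.le⟩).hasDerivWithinAt) (by simp)
    (fun s => (((hexp s).sub_const 1).const_mul (R / k)).const_add _)
    (fun s hs => by
      rw [norm_mul, norm_real, Real.norm_of_nonneg (Real.exp_pos _).le]
      have := hr s ⟨hs.1, hs.2.le⟩
      calc Real.exp (k * (s - a)) * ‖r s‖ ≤ Real.exp (k * (s - a)) * R := by gcongr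
        _ = _ := by field_simp)
    (Set.right_mem_Icc.2 hab)
  have hE : 1 ≤ Real.exp (k * (b - a)) :=
    Real.one_le_exp (mul_nonneg hk.le (sub_nonneg.2 hab))
  rw [norm_mul, norm_real, Real.norm_of_nonneg (Real.exp_pos _).le] at key
  have hRk : 0 ≤ R / k := by positivity
  nlinarith [norm_nonneg (f a), norm_nonneg (f b), mul_nonneg (norm_nonneg (f a)) (sub_nonneg.2 hE)]

/-- Reversing time turns growth into damping. -/
theorem norm_le_of_hasDerivAt_pos {f r : ℝ → ℂ} {a b k R : ℝ} (hk : 0 < k) (hab : a ≤ b)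
    (hR : 0 ≤ R) (hf : ∀ s ∈ Set.Icc a b, HasDerivAt f (k * f s + r s) s)
    (hr : ∀ s ∈ Set.Icc a b, ‖r s‖ ≤ R) : ‖f a‖ ≤ ‖f b‖ + R / k := by
  have hmem : ∀ s ∈ Set.Icc (-b) (-a), -s ∈ Set.Icc a b := fun s hs =>
    ⟨by linarith [hs.2], by linarith [hs.1]⟩
  have := norm_le_of_hasDerivAt_neg (f := fun s => f (-s)) (r := fun s => -r (-s)) (a := -b)
    (b := -a) hk (by linarith) hR (fun s hs => by
      have h := (hf (-s) (hmem s hs)).scomp s (hasDerivAt_neg s)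
      exact h.congr_deriv (by simp)) (fun s hs => by simpa using hr (-s) (hmem s hs))
  simpa using this

/-! ### Smooth trigonometric series with `ℓ¹` coefficients -/

section TrigonometricSeries

/-- The series `∑ aₙ (1 + |xₙ|)⁻ⁿ e^{-i xₙ t}`. -/
noncomputable def trigSeries (x : ℕ → ℝ) (a : ℕ → ℂ) (t : ℝ) : ℂ :=
  ∑' n, a n * ((1 + |x n|) ^ n)⁻¹ * exp (-(I * x n * t))

theorem iteratedDeriv_const_mul_exp (c : ℂ) (y : ℝ) (k : ℕ) :
    iteratedDeriv k (fun t : ℝ => c * exp (-(I * y * t))) =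
      fun t : ℝ => c * (-(I * y)) ^ k * exp (-(I * y * t)) := by
  induction k with
  | zero => simp
  | succ k ih =>
    rw [iteratedDeriv_succ, ih]
    funext t
    have h1 : HasDerivAt (fun t : ℝ => -(I * y * (t : ℂ))) (-(I * y * 1)) t :=
      ((hasDerivAt_id t).ofReal_comp.const_mul _).neg
    refine HasDerivAt.deriv ((h1.cexp.const_mul (c * (-(I * y)) ^ k)).congr_deriv ?_)
    ring

theorem norm_iteratedFDeriv_const_mul_exp (c : ℂ) (y : ℝ) (k : ℕ) (t : ℝ) :
    ‖iteratedFDeriv ℝ k (fun t : ℝ => c * exp (-(I * y * t))) t‖ = ‖c‖ * |y| ^ k := by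
  rw [norm_iteratedFDeriv_eq_norm_iteratedDeriv, iteratedDeriv_const_mul_exp]
  simp [norm_exp_neg_I_mul]

theorem norm_mul_inv_pow (c : ℂ) (y : ℝ) (n : ℕ) :
    ‖c * (((1 + |y|) ^ n)⁻¹ : ℝ)‖ = ‖c‖ * ((1 + |y|) ^ n)⁻¹ := by
  rw [norm_mul, norm_real, Real.norm_of_nonneg (by positivity)]

theorem norm_trigSeries_term_le (x : ℕ → ℝ) (a : ℕ → ℂ) (t : ℝ) (n : ℕ) :
    ‖a n * ((1 + |x n|) ^ n)⁻¹ * exp (-(I * x n * t))‖ ≤ ‖a n‖ := by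
  rw [norm_mul, norm_exp_neg_I_mul, mul_one, norm_mul_inv_pow]
  exact mul_le_of_le_one_right (norm_nonneg _)
    (inv_le_one_of_one_le₀ (one_le_pow₀ (by linarith [abs_nonneg (x n)])))

theorem summable_trigSeries (x : ℕ → ℝ) {a : ℕ → ℂ} (ha : Summable fun n => ‖a n‖) (t : ℝ) :
    Summable fun n => a n * ((1 + |x n|) ^ n)⁻¹ * exp (-(I * x n * t)) :=
  ha.of_norm_bounded (norm_trigSeries_term_le x a t)

theorem norm_trigSeries_le (x : ℕ → ℝ) {a : ℕ → ℂ} (ha : Summable fun n => ‖a n‖) (t : ℝ) :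
    ‖trigSeries x a t‖ ≤ ∑' n, ‖a n‖ :=
  tsum_of_norm_bounded ha.hasSum (norm_trigSeries_term_le x a t)

/-- The weight has exponent `n`, so for each fixed `k` it absorbs the factor `|xₙ|^k` of the `k`-th
derivative as soon as `n ≥ k`. No growth condition on `xₙ` is needed. -/
theorem contDiff_trigSeries (x : ℕ → ℝ) {a : ℕ → ℂ} (ha : Summable fun n => ‖a n‖) :
    ContDiff ℝ (⊤ : ℕ∞) (trigSeries x a) := by
  refine contDiff_tsum_of_eventually (v := fun _ n => ‖a n‖)
    (fun n => contDiff_const.mul (contDiff_exp_neg_I_mul (x n))) (fun _ _ => ha) fun k _ => ?_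
  rw [Nat.cofinite_eq_atTop]
  filter_upwards [eventually_ge_atTop k] with n hn t
  rw [norm_iteratedFDeriv_const_mul_exp, norm_mul_inv_pow, mul_assoc]
  refine mul_le_of_le_one_right (norm_nonneg _) ?_
  rw [inv_mul_le_iff₀ (by positivity), mul_one]
  calc |x n| ^ k ≤ (1 + |x n|) ^ k := by gcongr; linarith
    _ ≤ (1 + |x n|) ^ n := pow_le_pow_right₀ (by linarith [abs_nonneg (x n)]) hn

end TrigonometricSeries

/-! ### Polynomial bounds from uniform boundedness -/

section UniformBound

variable {α : ℝ} {G : ℂ → ℂ} {U : Set ℝ} {χ : ℝ → ℂ}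

theorem norm_lineFourier_le (σ x : ℝ) :
    ‖lineFourier G χ σ x‖ ≤ ∫ t : ℝ, ‖G (σ + I * t) * χ t‖ := by
  refine (norm_integral_le_integral_norm _).trans_eq (integral_congr_ae ?_)
  exact Eventually.of_forall fun t => by simp [norm_exp_neg_I_mul]

/-- Convergence gives a bound near `α`; continuity on a compact interval gives one on the rest. -/
theorem exists_bound_of_tendsto (hG : AnalyticOnNhd ℂ G {s : ℂ | α < s.re})
    (hχ : IsTest U χ) {L : ℂ}
    (hL : Tendsto (fun σ : ℝ => ∫ t : ℝ, G (σ + I * t) * χ t) (𝓝[>] α) (𝓝 L)) :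
    ∃ C, ∀ σ ∈ Set.Ioc α (α + 1), ‖∫ t : ℝ, G (σ + I * t) * χ t‖ ≤ C := by
  have hc : ContinuousOn (fun σ : ℝ => ∫ t : ℝ, G (σ + I * t) * χ t) (Set.Ioc α (α + 1)) :=
    fun σ hσ => (hasDerivAt_integral_line hG hσ.1 hχ.continuous
      hχ.hasCompactSupport).continuousAt.continuousWithinAt
  obtain ⟨C₁, hC₁⟩ := (isBoundedUnder_iff_eventually_bddAbove.1 hL.norm.isBoundedUnder_le)
  obtain ⟨⟨B, hB⟩, hC₁⟩ := hC₁
  obtain ⟨b, hb, hbs⟩ := (mem_nhdsGT_iff_exists_Ioo_subset).1 hC₁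
  have hb' : α < b := hb
  obtain ⟨C₂, hC₂⟩ := (isCompact_Icc (a := b) (b := α + 1)).exists_bound_of_continuousOn
    (hc.mono fun s hs => ⟨hb'.trans_le hs.1, hs.2⟩)
  refine ⟨max B C₂, fun σ hσ => ?_⟩
  rcases lt_or_ge σ b with h | h
  · exact (hB ⟨σ, hbs ⟨hσ.1, h⟩, rfl⟩).trans (le_max_left _ _)
  · exact (hC₂ σ ⟨h, hσ.2⟩).trans (le_max_right _ _)

/-- Boundedness of the pairings with all test functions implies, by the uniform boundedness
principle on `ℓ¹`, polynomial bounds for the Fourier transforms on vertical lines. -/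
theorem exists_polynomial_bound (hG : AnalyticOnNhd ℂ G {s : ℂ | α < s.re})
    (hlim : ∀ Φ, IsTest U Φ → ∃ L,
      Tendsto (fun σ : ℝ => ∫ t : ℝ, G (σ + I * t) * Φ t) (𝓝[>] α) (𝓝 L))
    (hχ : IsTest U χ) :
    ∃ (N : ℕ) (C : ℝ), ∀ σ ∈ Set.Ioc α (α + 1), ∀ x,
      ‖lineFourier G χ σ x‖ ≤ C * (1 + |x|) ^ N := by
  by_contra! hcon
  -- Taking degree and constant both equal to `n` yields one sequence of violations; its frequencies
  -- `xₙ` define the series used below.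
  choose s hs x hx using fun n : ℕ => hcon n n
  have hsum : ∀ a : lp (fun _ : ℕ => ℂ) 1, Summable fun n => ‖a n‖ := fun a => by
    simpa using (lp.memℓp a).summable (by simp)
  have hnorm : ∀ a : lp (fun _ : ℕ => ℂ) 1, ‖a‖ = ∑' n, ‖a n‖ := fun a => by
    simpa using lp.norm_eq_tsum_rpow (by simp) a
  have htest : ∀ a : lp (fun _ : ℕ => ℂ) 1, IsTest U fun t => trigSeries x a t * χ t :=
    fun a => hχ.mul_left (contDiff_trigSeries x (hsum a))
  have hint : ∀ σ ∈ Set.Ioc α (α + 1), ∀ a : lp (fun _ : ℕ => ℂ) 1,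
      Integrable fun t : ℝ => G (σ + I * t) * (trigSeries x a t * χ t) := fun σ hσ a =>
    integrable_line_mul hG hσ.1 (htest a).continuous (htest a).hasCompactSupport
  let T : Set.Ioc α (α + 1) → lp (fun _ : ℕ => ℂ) 1 →L[ℂ] ℂ := fun σ =>
    LinearMap.mkContinuous
      { toFun := fun a => ∫ t : ℝ, G ((σ : ℝ) + I * t) * (trigSeries x a t * χ t)
        map_add' := fun a b => by
          rw [← integral_add (hint _ σ.2 a) (hint _ σ.2 b)]
          refine integral_congr_ae (Eventually.of_forall fun t => ?_)
          have : trigSeries x (a + b : lp (fun _ : ℕ => ℂ) 1) t =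
              trigSeries x a t + trigSeries x b t := by
            simp only [trigSeries]
            rw [← (summable_trigSeries x (hsum a) t).tsum_add (summable_trigSeries x (hsum b) t)]
            simp [add_mul]
          simp only [this]
          ring
        map_smul' := fun c a => by
          rw [RingHom.id_apply, smul_eq_mul, ← integral_const_mul]
          refine integral_congr_ae (Eventually.of_forall fun t => ?_)
          have : trigSeries x (c • a : lp (fun _ : ℕ => ℂ) 1) t = c * trigSeries x a t := by
            simp only [trigSeries]
            rw [← tsum_mul_left]
            simp [mul_assoc]
          simp only [this]
          ring }
      (∫ t : ℝ, ‖G ((σ : ℝ) + I * t) * χ t‖) fun a => by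
        refine (norm_integral_le_integral_norm _).trans ?_
        refine le_of_le_of_eq ?_ ((integral_const_mul ‖a‖ _).trans (mul_comm _ _))
        refine (integral_mono (hint _ σ.2 a).norm
          ((integrable_line_mul hG σ.2.1 hχ.continuous hχ.hasCompactSupport).norm.const_mul _)
          fun t => ?_)
        have := norm_trigSeries_le x (hsum a) t
        rw [← hnorm] at this
        calc ‖G ((σ : ℝ) + I * t) * (trigSeries x a t * χ t)‖
            = ‖trigSeries x a t‖ * ‖G ((σ : ℝ) + I * t) * χ t‖ := by
              simp only [norm_mul]; ring
          _ ≤ _ := by gcongr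
  -- For fixed `a`, the series times `χ` is a single test function, whose pairings with `G` stay
  -- bounded as `σ` varies.
  obtain ⟨C, hC⟩ := banach_steinhaus (g := T) fun a => by
    obtain ⟨L, hL⟩ := hlim _ (htest a)
    obtain ⟨C, hC⟩ := exists_bound_of_tendsto hG (htest a) hL
    exact ⟨C, fun σ => hC σ σ.2⟩
  obtain ⟨n, hn⟩ := exists_nat_gt C
  -- The `n`-th unit vector isolates the weighted value at `xₙ`, which exceeds `n > C` by the choice
  -- of `xₙ`.
  have h1 := (T ⟨s n, hs n⟩).le_of_opNorm_le (hC _) (lp.single 1 n 1)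
  rw [lp.norm_single (by simp), norm_one, mul_one] at h1
  have hT : T ⟨s n, hs n⟩ (lp.single 1 n 1) =
      (((1 + |x n|) ^ n)⁻¹ : ℝ) * lineFourier G χ (s n) (x n) := by
    change ∫ t : ℝ, _ = _
    rw [lineFourier, ← integral_const_mul]
    refine integral_congr_ae (Eventually.of_forall fun t => ?_)
    have : trigSeries x (lp.single 1 n 1 : lp (fun _ : ℕ => ℂ) 1) t =
        (((1 + |x n|) ^ n)⁻¹ : ℝ) * exp (-(I * x n * t)) := by
      rw [trigSeries, tsum_eq_single n]
      · simp
      · intro m hm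
        simp [lp.single_apply, hm]
    simp only [this]
    ring
  have h2 := norm_mul_inv_pow 1 (x n) n
  rw [one_mul, norm_one, one_mul] at h2
  rw [hT, norm_mul, h2, inv_mul_le_iff₀ (by positivity)] at h1
  have h3 := hx n
  have h4 : (0 : ℝ) < (1 + |x n|) ^ n := by positivity
  nlinarith

end UniformBound

/-! ### Fourier representation, cutoffs and Fubini -/

theorem exists_schwartzFourier_eq (S : 𝓢(ℝ, ℂ)) : ∃ θ : 𝓢(ℝ, ℂ), schwartzFourier θ = S := by
  refine ⟨(FourierTransform.fourierCLE ℂ 𝓢(ℝ, ℂ)).symm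
    (SchwartzMap.compCLMOfContinuousLinearEquiv ℂ scaling.symm S), ?_⟩
  ext t
  simp [schwartzFourier]

theorem IsTest.exists_schwartz_fourier {U : Set ℝ} {χ : ℝ → ℂ} (hχ : IsTest U χ) :
    ∃ θ : 𝓢(ℝ, ℂ), ∀ t : ℝ, χ t = ∫ y : ℝ, exp (-(I * t * y)) * θ y := by
  obtain ⟨θ, hθ⟩ := exists_schwartzFourier_eq (hχ.hasCompactSupport.toSchwartzMap hχ.contDiff)
  refine ⟨θ, fun t => ?_⟩
  rw [← schwartzFourier_apply, hθ]
  rfl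

theorem exists_cutoff {U K : Set ℝ} (hU : IsOpen U) (hK : IsCompact K) (hKU : K ⊆ U) :
    ∃ χ : ℝ → ℂ, IsTest U χ ∧ ∀ t ∈ K, χ t = 1 := by
  obtain ⟨L, hL, hKL, hLU⟩ := exists_compact_between hK hU hKU
  obtain ⟨f, hf, -, hsupp, hone⟩ := exists_contMDiff_support_eq_eq_one_iff
    (modelWithCornersSelf ℝ ℝ) isOpen_interior hK.isClosed hKL
  have hts : tsupport (fun t => (f t : ℂ)) ⊆ L := by
    refine closure_minimal (fun t ht => ?_) hL.isClosed
    have : t ∈ Function.support f := fun h => ht (by simp [h])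
    exact interior_subset (hsupp ▸ this)
  refine ⟨fun t => (f t : ℂ), ⟨ofRealCLM.contDiff.comp hf.contDiff,
    hL.of_isClosed_subset (isClosed_tsupport _) hts, hts.trans hLU⟩, fun t ht => ?_⟩
  simp [(hone t).1 ht]

theorem integral_mul_fourier {W ψ : ℝ → ℂ} (hW : Integrable W) (hψ : Integrable ψ) :
    ∫ t : ℝ, W t * ∫ y : ℝ, exp (-(I * t * y)) * ψ y =
      ∫ y : ℝ, ψ y * ∫ t : ℝ, W t * exp (-(I * y * t)) := by
  have hi : Integrable (fun p : ℝ × ℝ => exp (-(I * p.1 * p.2)) * (W p.1 * ψ p.2))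
      (volume.prod volume) :=
    (hW.mul_prod hψ).bdd_mul (c := 1) (by fun_prop)
      (Eventually.of_forall fun p => (norm_exp_neg_I_mul p.1 p.2).le)
  simp only [← integral_const_mul]
  have hi' : Integrable (Function.uncurry fun t y : ℝ => W t * (exp (-(I * t * y)) * ψ y))
      (volume.prod volume) := hi.congr (Eventually.of_forall fun p => by
        simp only [Function.uncurry]; ring)
  rw [integral_integral_swap hi']
  refine integral_congr_ae (Eventually.of_forall fun y =>
    integral_congr_ae (Eventually.of_forall fun t => ?_))
  simp only
  rw [mul_right_comm I (t : ℂ) y]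
  ring

/-! ### From polynomial to uniform bounds -/

section HalfPlane

variable {α : ℝ} {G : ℂ → ℂ} {U : Set ℝ} {χ : ℝ → ℂ}

theorem integral_line_mul_fourier (hG : AnalyticOnNhd ℂ G {s : ℂ | α < s.re}) {σ : ℝ}
    (hσ : α < σ) (hχ : IsTest U χ) {φ ψ : ℝ → ℂ} (hψ : Integrable ψ)
    (hφ : ∀ t : ℝ, φ t = ∫ y : ℝ, exp (-(I * t * y)) * ψ y) (h : ℝ) :
    ∫ t : ℝ, G (σ + I * t) * (exp (I * h * t) * (χ t * φ t)) =
      ∫ y : ℝ, ψ y * lineFourier G χ σ (y - h) := by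
  have hm := hχ.modulate (-h)
  have := integral_mul_fourier (integrable_line_mul hG hσ hm.continuous hm.hasCompactSupport) hψ
  calc _ = ∫ t : ℝ, G (σ + I * t) * (exp (-(I * (-h : ℝ) * t)) * χ t) *
        ∫ y : ℝ, exp (-(I * t * y)) * ψ y := by
        refine integral_congr_ae (Eventually.of_forall fun t => ?_)
        simp only [hφ, ofReal_neg, mul_neg, neg_mul, neg_neg]
        ring
    _ = _ := by
        rw [this]
        refine integral_congr_ae (Eventually.of_forall fun y => ?_)
        simp only [lineFourier]
        congr 1
        refine integral_congr_ae (Eventually.of_forall fun t => ?_)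
        have : exp (-(I * (y - h : ℝ) * t)) = exp (-(I * (-h : ℝ) * t)) * exp (-(I * y * t)) := by
          rw [← exp_add]; push_cast; ring_nf
        simp only [this]
        ring

/-- Multiplication by `χ` is averaging on the Fourier side, so information about a wider cutoff `χ₁`
passes to every `χ` supported where `χ₁ = 1`. -/
theorem lineFourier_eq_integral (hG : AnalyticOnNhd ℂ G {s : ℂ | α < s.re}) {σ : ℝ}
    (hσ : α < σ) {χ₁ : ℝ → ℂ} (hχ₁ : IsTest U χ₁) (hone : ∀ t ∈ tsupport χ, χ₁ t = 1)
    {ψ : ℝ → ℂ} (hψ : Integrable ψ)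
    (hχ : ∀ t : ℝ, χ t = ∫ y : ℝ, exp (-(I * t * y)) * ψ y) (x : ℝ) :
    lineFourier G χ σ x = ∫ y : ℝ, ψ y * lineFourier G χ₁ σ (y + x) := by
  have := integral_line_mul_fourier hG hσ hχ₁ hψ hχ (-x)
  simp only [sub_neg_eq_add] at this
  rw [← this, lineFourier]
  refine integral_congr_ae (Eventually.of_forall fun t => ?_)
  by_cases ht : t ∈ tsupport χ
  · simp [hone t ht]
  · simp [image_eq_zero_of_notMem_tsupport ht]

theorem _root_.SchwartzMap.integrable_norm_mul_one_add_abs_pow (θ : 𝓢(ℝ, ℂ)) (N : ℕ) :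
    Integrable fun y : ℝ => ‖θ y‖ * (1 + |y|) ^ N := by
  have h0 := θ.integrable_pow_mul volume 0
  have hN := θ.integrable_pow_mul volume N
  refine ((h0.add hN).const_mul (2 ^ (N - 1))).mono' (by fun_prop) ?_
  refine Eventually.of_forall fun y => ?_
  have := add_pow_le zero_le_one (abs_nonneg y) N
  rw [Real.norm_of_nonneg (by positivity)]
  calc ‖θ y‖ * (1 + |y|) ^ N ≤ ‖θ y‖ * (2 ^ (N - 1) * (1 ^ N + |y| ^ N)) := by gcongr
    _ = _ := by simp; ring

/-- Schwartz decay absorbs the growth, since `1 + |y+x| ≤ (1+|y|)(1+|x|)`. The exponent is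
unchanged, so one `N` serves `χ` and all its derivatives. -/
theorem polynomial_bound_of_cutoff (hG : AnalyticOnNhd ℂ G {s : ℂ | α < s.re})
    (hχ : IsTest U χ) {χ₁ : ℝ → ℂ} (hχ₁ : IsTest U χ₁) (hone : ∀ t ∈ tsupport χ, χ₁ t = 1)
    {N : ℕ} {C : ℝ} {S : Set ℝ} (hS : ∀ σ ∈ S, α < σ)
    (hC : ∀ σ ∈ S, ∀ x, ‖lineFourier G χ₁ σ x‖ ≤ C * (1 + |x|) ^ N) :
    ∃ C', ∀ σ ∈ S, ∀ x, ‖lineFourier G χ σ x‖ ≤ C' * (1 + |x|) ^ N := by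
  obtain ⟨θ, hθ⟩ := hχ.exists_schwartz_fourier
  refine ⟨∫ y : ℝ, |C| * (‖θ y‖ * (1 + |y|) ^ N), fun σ hσ x => ?_⟩
  rw [lineFourier_eq_integral hG (hS σ hσ) hχ₁ hone θ.integrable hθ, ← integral_mul_const]
  refine norm_integral_le_of_norm_le
    (((θ.integrable_norm_mul_one_add_abs_pow N).const_mul _).mul_const _)
    (Eventually.of_forall fun y => ?_)
  have h1 : 1 + |y + x| ≤ (1 + |y|) * (1 + |x|) := by
    nlinarith [abs_add_le y x, mul_nonneg (abs_nonneg y) (abs_nonneg x)]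
  rw [norm_mul]
  calc ‖θ y‖ * ‖lineFourier G χ₁ σ (y + x)‖
      ≤ ‖θ y‖ * (|C| * ((1 + |y|) * (1 + |x|)) ^ N) := by
        gcongr
        refine (hC σ hσ (y + x)).trans ?_
        gcongr
        exact le_abs_self C
    _ = _ := by rw [mul_pow]; ring

theorem polynomial_bound_of_succ (hG : AnalyticOnNhd ℂ G {s : ℂ | α < s.re})
    (hχ : IsTest U χ) {B : ℝ}
    (hB : ∀ x, ∃ L, Tendsto (fun σ => lineFourier G χ σ x) (𝓝[>] α) (𝓝 L) ∧ ‖L‖ ≤ B)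
    {N : ℕ} {C₀ C₁ : ℝ}
    (h₀ : ∀ σ ∈ Set.Ioc α (α + 1), ∀ x, ‖lineFourier G χ σ x‖ ≤ C₀ * (1 + |x|) ^ (N + 1))
    (h₁ : ∀ σ ∈ Set.Ioc α (α + 1), ∀ x, ‖lineFourier G (deriv χ) σ x‖ ≤ C₁ * (1 + |x|) ^ (N + 1)) :
    ∃ C, ∀ σ ∈ Set.Ioc α (α + 1), ∀ x, ‖lineFourier G χ σ x‖ ≤ C * (1 + |x|) ^ N := by
  set D : ℝ := ∫ t : ℝ, ‖G ((α + 1 : ℝ) + I * t) * χ t‖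
  have hD0 : 0 ≤ D := integral_nonneg fun t => norm_nonneg _
  have hD : ∀ x, ‖lineFourier G χ (α + 1) x‖ ≤ D := norm_lineFourier_le (α + 1)
  have hB0 : 0 ≤ B := by
    obtain ⟨L, -, hL⟩ := hB 0
    exact (norm_nonneg L).trans hL
  refine ⟨2 * |C₀| + B + D + 2 * |C₁|, fun σ hσ x => ?_⟩
  set p : ℝ := (1 + |x|) ^ N with hp
  have hp1 : 1 ≤ p := one_le_pow₀ (by linarith [abs_nonneg x])
  have hC₀p : 0 ≤ |C₀| * p := by positivity
  have hC₁p : 0 ≤ |C₁| * p := by positivity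
  have hBp : B ≤ B * p := le_mul_of_one_le_right hB0 hp1
  have hDp : D ≤ D * p := le_mul_of_one_le_right hD0 hp1
  rcases le_or_gt |x| 1 with hx | hx
  · have h2 : C₀ * (1 + |x|) ^ (N + 1) ≤ |C₀| * (p * 2) := by
      rw [pow_succ, ← hp]
      gcongr
      · exact le_abs_self C₀
      · linarith
    linarith [h₀ σ hσ x]
  set R : ℝ := |C₁| * (1 + |x|) ^ (N + 1) with hR
  have hR0 : 0 ≤ R := by positivity
  have hx0 : 0 < |x| := by linarith
  -- As `|x| > 1`, `1 + |x| ≤ 2|x|`: dividing by the damping rate `|x|` gains one power.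
  have hRx : R / |x| ≤ 2 * |C₁| * p := by
    rw [div_le_iff₀ hx0, hR, pow_succ, ← hp]
    nlinarith
  have hr : ∀ s ∈ Set.Ioc α (α + 1), ‖I * lineFourier G (deriv χ) s x‖ ≤ R := fun s hs => by
    rw [norm_mul, norm_I, one_mul]
    refine (h₁ s hs x).trans ?_
    rw [hR]
    gcongr
    exact le_abs_self C₁
  rcases lt_or_ge x 0 with hneg | hpos
  -- For `x < 0` the equation is damped as `σ` increases: start at `s > α` and let `s → α⁺`, where
  -- the boundary value is at most `B`. For `x > 0` it is damped as `σ` decreases, and the start is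
  -- `α + 1`.
  · obtain ⟨L, hL, hLB⟩ := hB x
    have : ‖lineFourier G χ σ x‖ ≤ ‖L‖ + R / |x| := by
      refine ge_of_tendsto (hL.norm.add_const (R / |x|)) ?_
      filter_upwards [Ioo_mem_nhdsGT hσ.1] with s hs
      refine norm_le_of_hasDerivAt_neg (f := fun s => lineFourier G χ s x) hx0 hs.2.le hR0 (fun u hu => ?_)
        (fun u hu => hr u ⟨hs.1.trans_le hu.1, hu.2.trans hσ.2⟩)
      have := hasDerivAt_lineFourier hG (hs.1.trans_le hu.1) hχ x
      rwa [abs_of_neg hneg, ofReal_neg, neg_neg]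
    linarith
  · have : ‖lineFourier G χ σ x‖ ≤ ‖lineFourier G χ (α + 1) x‖ + R / |x| := by
      refine norm_le_of_hasDerivAt_pos (f := fun s => lineFourier G χ s x) hx0 hσ.2 hR0 (fun u hu => ?_)
        (fun u hu => hr u ⟨hσ.1.trans_le hu.1, hu.2⟩)
      have := hasDerivAt_lineFourier hG (hσ.1.trans_le hu.1) hχ x
      rwa [abs_of_nonneg hpos]
    linarith [hD x]

/-- If the boundary values of the Fourier transforms are bounded, so are the Fourier transforms
on all vertical lines close to the boundary. -/
theorem exists_uniform_bound (hG : AnalyticOnNhd ℂ G {s : ℂ | α < s.re}) (hU : IsOpen U)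
    (hlim : ∀ Φ, IsTest U Φ → ∃ L,
      Tendsto (fun σ : ℝ => ∫ t : ℝ, G (σ + I * t) * Φ t) (𝓝[>] α) (𝓝 L))
    (hbdd : ∀ χ, IsTest U χ → ∃ B, ∀ x, ∃ L,
      Tendsto (fun σ => lineFourier G χ σ x) (𝓝[>] α) (𝓝 L) ∧ ‖L‖ ≤ B)
    (hχ : IsTest U χ) :
    ∃ C, ∀ σ ∈ Set.Ioc α (α + 1), ∀ x, ‖lineFourier G χ σ x‖ ≤ C := by
  obtain ⟨χ₁, hχ₁, hone⟩ := exists_cutoff hU hχ.hasCompactSupport hχ.tsupport_subset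
  obtain ⟨N, C, hC⟩ := exists_polynomial_bound hG hlim hχ₁
  -- Each descent for `χ'` uses the bound for its derivative, so the induction must run over all
  -- test functions supported in `tsupport χ` at once.
  have key : ∀ k ≤ N, ∀ χ', IsTest (tsupport χ) χ' → ∃ C, ∀ σ ∈ Set.Ioc α (α + 1), ∀ x,
      ‖lineFourier G χ' σ x‖ ≤ C * (1 + |x|) ^ k := by
    intro k hk
    induction hk using Nat.decreasingInduction with
    | self =>
      intro χ' hχ'
      exact polynomial_bound_of_cutoff hG (hχ'.mono (hχ'.tsupport_subset.trans hχ.tsupport_subset))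
        hχ₁ (fun t ht => hone t (hχ'.tsupport_subset ht)) (fun σ hσ => hσ.1) hC
    | of_succ k _ ih =>
      intro χ' hχ'
      have hχU := hχ'.mono (hχ'.tsupport_subset.trans hχ.tsupport_subset)
      obtain ⟨B, hB⟩ := hbdd χ' hχU
      obtain ⟨C₀, h₀⟩ := ih χ' hχ'
      obtain ⟨C₁, h₁⟩ := ih _ hχ'.deriv
      exact polynomial_bound_of_succ hG hχU hB h₀ h₁
  simpa using key 0 N.zero_le χ (hχ.mono subset_rfl)

theorem continuous_lineFourier (hG : AnalyticOnNhd ℂ G {s : ℂ | α < s.re}) {σ : ℝ}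
    (hσ : α < σ) (hχ : IsTest U χ) : Continuous (lineFourier G χ σ) := by
  have hc := continuous_line hG hσ
  have hχc := hχ.continuous
  refine continuous_of_dominated (bound := fun t => ‖G (σ + I * t) * χ t‖)
    (fun x => (hc.mul (by fun_prop)).aestronglyMeasurable) (fun x => Eventually.of_forall fun t => ?_)
    (integrable_line_mul hG hσ hχ.continuous hχ.hasCompactSupport).norm
    (Eventually.of_forall fun t => by fun_prop)
  simp [norm_exp_neg_I_mul]

end HalfPlane

/-! ### Localization and boundary Fourier transforms -/

theorem IsTest.exists_decomposition {U : Set ℝ} {χ : ℝ → ℂ} (hχ : IsTest U χ) {ι : Type}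
    [Fintype ι] {V : ι → Set ℝ} (hV : ∀ i, IsOpen (V i)) (hcover : tsupport χ ⊆ ⋃ i, V i) :
    ∃ χ' : ι → ℝ → ℂ, (∀ i, IsTest (V i) (χ' i)) ∧ ∀ t, χ t = ∑ i, χ' i t := by
  obtain ⟨ρ, hρ⟩ := SmoothPartitionOfUnity.exists_isSubordinate (modelWithCornersSelf ℝ ℝ)
    (isClosed_tsupport χ) V hV hcover
  refine ⟨fun i t => (ρ i t : ℂ) * χ t, fun i => ?_, fun t => ?_⟩
  · refine (hχ.mul_left (ofRealCLM.contDiff.comp (ρ i).contMDiff.contDiff)).mono ?_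
    refine (tsupport_mul_subset_left (g := χ)).trans (subset_trans ?_ (hρ i))
    refine closure_mono fun t ht => ?_
    exact fun h => ht (by simp [h])
  · rw [← Finset.sum_mul]
    by_cases ht : t ∈ tsupport χ
    · have h := ρ.sum_eq_one ht
      rw [finsum_eq_sum_of_fintype] at h
      rw [← ofReal_sum, h]
      simp
    · simp [image_eq_zero_of_notMem_tsupport ht]

section Local

variable {α : ℝ} {G : ℂ → ℂ}

/-- `ℓ` is the Fourier transform of the boundary value of `χ G`. -/
def IsBoundaryFourier (α : ℝ) (G : ℂ → ℂ) (χ : ℝ → ℂ) (ℓ : ℝ → ℂ) : Prop :=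
  ∀ x, Tendsto (fun σ => lineFourier G χ σ x) (𝓝[>] α) (𝓝 (ℓ x))

theorem lineFourier_sum (hG : AnalyticOnNhd ℂ G {s : ℂ | α < s.re}) {σ : ℝ} (hσ : α < σ)
    {ι : Type} [Fintype ι] {V : ι → Set ℝ} {χ : ℝ → ℂ} {χ' : ι → ℝ → ℂ}
    (hχ' : ∀ i, IsTest (V i) (χ' i)) (hsum : ∀ t, χ t = ∑ i, χ' i t) (x : ℝ) :
    lineFourier G χ σ x = ∑ i, lineFourier G (χ' i) σ x := by
  simp only [lineFourier, hsum, Finset.mul_sum]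
  exact integral_finsetSum _ fun i _ => integrable_line_mul hG hσ
    ((hχ' i).modulate x).continuous ((hχ' i).modulate x).hasCompactSupport

/-- An additive property of boundary Fourier transforms is local. -/
theorem exists_isBoundaryFourier_of_local (hG : AnalyticOnNhd ℂ G {s : ℂ | α < s.re})
    {U : Set ℝ} {P : (ℝ → ℂ) → Prop} (hzero : P 0) (hadd : ∀ ℓ₁ ℓ₂, P ℓ₁ → P ℓ₂ → P (ℓ₁ + ℓ₂))
    (hloc : ∀ t ∈ U, ∃ V : Set ℝ, IsOpen V ∧ t ∈ V ∧
      ∀ χ, IsTest V χ → ∃ ℓ, IsBoundaryFourier α G χ ℓ ∧ P ℓ)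
    {χ : ℝ → ℂ} (hχ : IsTest U χ) : ∃ ℓ, IsBoundaryFourier α G χ ℓ ∧ P ℓ := by
  choose! V hVo htV hV using hloc
  obtain ⟨T, hT, hTcover⟩ := IsCompact.elim_nhds_subcover (s := tsupport χ)
    hχ.hasCompactSupport V
    fun t ht => (hVo t (hχ.tsupport_subset ht)).mem_nhds (htV t (hχ.tsupport_subset ht))
  obtain ⟨χ', hχ', hsum⟩ := hχ.exists_decomposition (ι := T) (V := fun t => V t)
    (fun t => hVo t (hχ.tsupport_subset (hT t t.2)))
    (hTcover.trans (Set.iUnion₂_subset fun t ht => Set.subset_iUnion (fun t : T => V t) ⟨t, ht⟩))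
  choose ℓ hℓ hP using fun t : T => hV t (hχ.tsupport_subset (hT t t.2)) _ (hχ' t)
  refine ⟨∑ t, ℓ t, fun x => ?_, Finset.sum_induction _ P hadd hzero fun t _ => hP t⟩
  rw [Finset.sum_apply]
  refine (tendsto_finsetSum _ fun t _ => hℓ t x).congr' ?_
  filter_upwards [self_mem_nhdsWithin] with σ hσ
  exact (lineFourier_sum hG hσ hχ' hsum x).symm

variable {U : Opens ℝ} {g : 𝓓(U, ℂ) →L[ℂ] ℂ}

theorem schwartzFourier_compSubConst (θ : 𝓢(ℝ, ℂ)) (x t : ℝ) :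
    schwartzFourier (θ.compSubConstCLM ℂ x) t = exp (-(I * x * t)) * schwartzFourier θ t := by
  simp only [schwartzFourier_apply, SchwartzMap.compSubConstCLM_apply]
  rw [← integral_add_right_eq_self _ x, ← integral_const_mul]
  refine integral_congr_ae (Eventually.of_forall fun y => ?_)
  simp only [add_sub_cancel_right, ← mul_assoc, ← exp_add]
  push_cast
  ring_nf

/-- With `χ = θ̂`, modulating `χ` by `e^{-ixt}` translates `θ` by `x`. Testing `f` on the result
pairs `F` with the translate. -/
theorem exists_isBoundaryFourier_of_coincidesOn (hg : HasBoundaryDistribution G α g)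
    {V : Opens ℝ} (hVU : V ≤ U) {f : 𝓢'(ℝ, ℂ)} (hf : CoincidesOn g f V) {F : ℝ → ℂ}
    (hF : ∀ φ : 𝓢(ℝ, ℂ), temperedFourier f φ = ∫ x : ℝ, F x * φ x)
    {χ : ℝ → ℂ} (hχ : IsTest V χ) :
    ∃ θ : 𝓢(ℝ, ℂ), IsBoundaryFourier α G χ fun x => ∫ y : ℝ, F (y + x) * θ y := by
  obtain ⟨θ, hθ⟩ := exists_schwartzFourier_eq (hχ.hasCompactSupport.toSchwartzMap hχ.contDiff)
  refine ⟨θ, fun x => ?_⟩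
  have hm := (hχ.mono (hχ.tsupport_subset.trans hVU)).modulate x
  let Φ : 𝓓(U, ℂ) := ⟨_, hm.contDiff, hm.hasCompactSupport, hm.tsupport_subset⟩
  have hΦ : g Φ = ∫ y : ℝ, F (y + x) * θ y := by
    have h1 : Φ.hasCompactSupport.toSchwartzMap Φ.contDiff =
        schwartzFourier (θ.compSubConstCLM ℂ x) := by
      ext t
      rw [schwartzFourier_compSubConst, hθ]
      rfl
    rw [hf Φ (hχ.modulate x).tsupport_subset, h1, ← temperedFourier_apply, hF,
      ← integral_add_right_eq_self _ x]
    simp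
  beta_reduce
  rw [← hΦ]
  exact hg Φ

theorem ae_norm_translate_le {F : ℝ → ℂ} (hF : MemLp F ∞ volume) :
    ∃ M, 0 ≤ M ∧ ∀ x, ∀ᵐ y : ℝ, ‖F (y + x)‖ ≤ M :=
  ⟨(eLpNorm F ∞ volume).toReal, ENNReal.toReal_nonneg, fun x =>
    (measurePreserving_add_right volume x).quasiMeasurePreserving.ae <| by
      filter_upwards [ae_le_eLpNormEssSup (f := F) (μ := volume)] with y hy
      rw [← eLpNorm_exponent_top] at hy
      simpa using ENNReal.toReal_mono hF.2.ne hy⟩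

theorem exists_bound_integral_translate {F : ℝ → ℂ} (hF : MemLp F ∞ volume) (θ : 𝓢(ℝ, ℂ)) :
    ∃ B, ∀ x, ‖∫ y : ℝ, F (y + x) * θ y‖ ≤ B := by
  obtain ⟨M, -, hM⟩ := ae_norm_translate_le hF
  refine ⟨∫ y : ℝ, M * ‖θ y‖, fun x => norm_integral_le_of_norm_le
    (θ.integrable.norm.const_mul M) ?_⟩
  filter_upwards [hM x] with y hy
  rw [norm_mul]
  gcongr

/-- The limit is taken at `-∞` because `I_φ(h)` samples the boundary transform at `y - h` with `h →
+∞`. -/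
theorem tendsto_integral_translate {F : ℝ → ℂ} (hF : MemLp F ∞ volume)
    (hF0 : Tendsto F (cocompact ℝ) (𝓝 0)) (θ : 𝓢(ℝ, ℂ)) :
    Tendsto (fun x => ∫ y : ℝ, F (y + x) * θ y) atBot (𝓝 0) := by
  obtain ⟨M, -, hM⟩ := ae_norm_translate_le hF
  have : Tendsto (fun x => ∫ y : ℝ, F (y + x) * θ y) atBot (𝓝 (∫ _ : ℝ, (0 : ℂ))) := by
    refine tendsto_integral_filter_of_dominated_convergence (fun y => M * ‖θ y‖)
      (Eventually.of_forall fun x => ?_) (Eventually.of_forall fun x => ?_)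
      (θ.integrable.norm.const_mul M) (Eventually.of_forall fun y => ?_)
    · exact (hF.1.comp_measurePreserving (measurePreserving_add_right volume x)).mul
        θ.continuous.aestronglyMeasurable
    · filter_upwards [hM x] with y hy
      rw [norm_mul]
      gcongr
    · have h := (hF0.comp atBot_le_cocompact).comp (tendsto_atBot_add_const_left atBot y tendsto_id)
      simpa using h.mul_const (θ y)
  simpa using this

theorem exists_isBoundaryFourier_bounded (hG : AnalyticOnNhd ℂ G {s : ℂ | α < s.re})
    (hg : HasBoundaryDistribution G α g) (hpm : IsLocalPseudomeasure g) {χ : ℝ → ℂ}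
    (hχ : IsTest U χ) : ∃ ℓ, IsBoundaryFourier α G χ ℓ ∧ ∃ B, ∀ x, ‖ℓ x‖ ≤ B := by
  refine exists_isBoundaryFourier_of_local hG (P := fun ℓ => ∃ B, ∀ x, ‖ℓ x‖ ≤ B)
    ⟨0, by simp⟩ ?_ (fun t ht => ?_) hχ
  · rintro ℓ₁ ℓ₂ ⟨B₁, h₁⟩ ⟨B₂, h₂⟩
    exact ⟨B₁ + B₂, fun x => norm_add_le_of_le (h₁ x) (h₂ x)⟩
  · obtain ⟨V, htV, hVU, f, ⟨F, hF, hfF⟩, hgf⟩ := hpm t ht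
    refine ⟨V, V.isOpen, htV, fun χ hχ => ?_⟩
    obtain ⟨θ, hθ⟩ := exists_isBoundaryFourier_of_coincidesOn hg hVU hgf hfF hχ
    exact ⟨_, hθ, exists_bound_integral_translate hF θ⟩

theorem IsLocalPseudofunction.isLocalPseudomeasure (h : IsLocalPseudofunction g) :
    IsLocalPseudomeasure g := fun t ht => by
  obtain ⟨V, htV, hVU, f, ⟨F, hF, -, hfF⟩, hgf⟩ := h t ht
  exact ⟨V, htV, hVU, f, ⟨F, hF, hfF⟩, hgf⟩

theorem exists_isBoundaryFourier_tendsto (hG : AnalyticOnNhd ℂ G {s : ℂ | α < s.re})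
    (hg : HasBoundaryDistribution G α g) (hpf : IsLocalPseudofunction g) {χ : ℝ → ℂ}
    (hχ : IsTest U χ) : ∃ ℓ, IsBoundaryFourier α G χ ℓ ∧ Tendsto ℓ atBot (𝓝 0) := by
  refine exists_isBoundaryFourier_of_local hG (P := fun ℓ => Tendsto ℓ atBot (𝓝 0))
    tendsto_const_nhds (fun ℓ₁ ℓ₂ h₁ h₂ => by
      have h := h₁.add h₂
      rwa [add_zero] at h) (fun t ht => ?_) hχ
  obtain ⟨V, htV, hVU, f, ⟨F, hF, hF0, hfF⟩, hgf⟩ := hpf t ht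
  refine ⟨V, V.isOpen, htV, fun χ hχ => ?_⟩
  obtain ⟨θ, hθ⟩ := exists_isBoundaryFourier_of_coincidesOn hg hVU hgf hfF hχ
  exact ⟨_, hθ, tendsto_integral_translate hF hF0 θ⟩

end Local

/-! ### Passage to functions of the Wiener algebra -/

section Wiener

variable {α : ℝ} {G : ℂ → ℂ} {U : Opens ℝ} {g : 𝓓(U, ℂ) →L[ℂ] ℂ}

/-- Dominated convergence with majorant `C ‖ψ‖`, where `C` is the uniform bound on the lines near
the boundary. -/
theorem exists_isBoundaryLimit (hG : AnalyticOnNhd ℂ G {s : ℂ | α < s.re})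
    (hg : HasBoundaryDistribution G α g) (hpm : IsLocalPseudomeasure g) {χ : ℝ → ℂ}
    (hχ : IsTest U χ) {φ ψ : ℝ → ℂ} (hone : ∀ t ∈ tsupport φ, χ t = 1) (hψ : Integrable ψ)
    (hφ : ∀ t : ℝ, φ t = ∫ y : ℝ, exp (-(I * t * y)) * ψ y) {ℓ : ℝ → ℂ}
    (hℓ : IsBoundaryFourier α G χ ℓ) (h : ℝ) :
    IsBoundaryLimit G α φ h (∫ y : ℝ, ψ y * ℓ (y - h)) := by
  obtain ⟨C, hC⟩ := exists_uniform_bound hG U.isOpen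
    (fun Φ hΦ => ⟨_, hg ⟨Φ, hΦ.contDiff, hΦ.hasCompactSupport, hΦ.tsupport_subset⟩⟩)
    (fun χ hχ => by
      obtain ⟨ℓ, hℓ, B, hB⟩ := exists_isBoundaryFourier_bounded hG hg hpm hχ
      exact ⟨B, fun x => ⟨ℓ x, hℓ x, hB x⟩⟩) hχ
  have hev : ∀ᶠ σ in 𝓝[>] α, σ ∈ Set.Ioc α (α + 1) := Ioc_mem_nhdsGT (by linarith)
  have key : Tendsto (fun σ => ∫ y : ℝ, ψ y * lineFourier G χ σ (y - h)) (𝓝[>] α)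
      (𝓝 (∫ y : ℝ, ψ y * ℓ (y - h))) := by
    refine tendsto_integral_filter_of_dominated_convergence (fun y => ‖ψ y‖ * C) ?_ ?_
      (hψ.norm.mul_const C) (Eventually.of_forall fun y => (hℓ (y - h)).const_mul (ψ y))
    · filter_upwards [hev] with σ hσ
      exact hψ.aestronglyMeasurable.mul ((continuous_lineFourier hG hσ.1 hχ).comp
        (continuous_sub_right h)).aestronglyMeasurable
    · filter_upwards [hev] with σ hσ
      refine Eventually.of_forall fun y => ?_
      rw [norm_mul]
      gcongr
      exact hC σ hσ _
  refine key.congr' ?_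
  filter_upwards [hev] with σ hσ
  rw [← integral_line_mul_fourier hG hσ.1 hχ hψ hφ h]
  refine integral_congr_ae (Eventually.of_forall fun t => ?_)
  by_cases ht : t ∈ tsupport φ
  · simp [hone t ht, mul_assoc]
  · simp [image_eq_zero_of_notMem_tsupport ht]

theorem norm_integral_mul_translate_le {ψ ℓ : ℝ → ℂ} (hψ : Integrable ψ) {B : ℝ}
    (hB : ∀ x, ‖ℓ x‖ ≤ B) (h : ℝ) : ‖∫ y : ℝ, ψ y * ℓ (y - h)‖ ≤ ∫ y : ℝ, ‖ψ y‖ * B :=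
  norm_integral_le_of_norm_le (hψ.norm.mul_const B) (Eventually.of_forall fun y => by
    rw [norm_mul]
    gcongr
    exact hB _)

/-- A pointwise limit of continuous functions along a sequence `σ → α⁺`; this supplies the
measurability for dominated convergence in `h`. -/
theorem IsBoundaryFourier.measurable (hG : AnalyticOnNhd ℂ G {s : ℂ | α < s.re}) {χ ℓ : ℝ → ℂ}
    (hχ : IsTest U χ) (hℓ : IsBoundaryFourier α G χ ℓ) : Measurable ℓ := by
  obtain ⟨s, hs⟩ := exists_seq_tendsto (𝓝[>] α)
  have hs' := (hs.eventually (self_mem_nhdsWithin : Set.Ioi α ∈ 𝓝[>] α)).exists_forall_of_atTop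
  obtain ⟨n₀, hn₀⟩ := hs'
  refine measurable_of_tendsto_metrizable (f := fun n => lineFourier G χ (s (n + n₀)))
    (fun n => (continuous_lineFourier hG (hn₀ _ (Nat.le_add_left _ _)) hχ).measurable)
    (tendsto_pi_nhds.2 fun x => ?_)
  exact (hℓ x).comp (hs.comp (tendsto_add_atTop_nat n₀))

theorem hasPseudomeasureBoundaryWrt (hG : AnalyticOnNhd ℂ G {s : ℂ | α < s.re})
    (hbdry : HasLocalPseudomeasureBoundary G α U) {φ : ℝ → ℂ} (hφ : φ ∈ wienerAlgebraCompact)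
    (hsupp : tsupport φ ⊆ U) : HasPseudomeasureBoundaryWrt G α φ := by
  obtain ⟨g, hpm, hg⟩ := hbdry
  obtain ⟨⟨ψ, hψ, hφψ⟩, hφc⟩ := hφ
  obtain ⟨χ, hχ, hone⟩ := exists_cutoff U.isOpen hφc hsupp
  obtain ⟨ℓ, hℓ, B, hB⟩ := exists_isBoundaryFourier_bounded hG hg hpm hχ
  -- The limit exists for every real `h`, so the threshold 1 is arbitrary.
  refine ⟨1, one_pos, fun h => ∫ y : ℝ, ψ y * ℓ (y - h),
    fun h _ => exists_isBoundaryLimit hG hg hpm hχ hone hψ hφψ hℓ h, ?_⟩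
  exact IsBigO.of_bound (∫ y : ℝ, ‖ψ y‖ * B) (Eventually.of_forall fun h => by
    simpa using norm_integral_mul_translate_le hψ hB h)

theorem hasPseudofunctionBoundaryWrt (hG : AnalyticOnNhd ℂ G {s : ℂ | α < s.re})
    (hbdry : HasLocalPseudofunctionBoundary G α U) {φ : ℝ → ℂ} (hφ : φ ∈ wienerAlgebraCompact)
    (hsupp : tsupport φ ⊆ U) : HasPseudofunctionBoundaryWrt G α φ := by
  obtain ⟨g, hpf, hg⟩ := hbdry
  have hpm := hpf.isLocalPseudomeasure
  obtain ⟨⟨ψ, hψ, hφψ⟩, hφc⟩ := hφ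
  obtain ⟨χ, hχ, hone⟩ := exists_cutoff U.isOpen hφc hsupp
  obtain ⟨ℓ, hℓ, B, hB⟩ := exists_isBoundaryFourier_bounded hG hg hpm hχ
  obtain ⟨ℓ', hℓ', hzero⟩ := exists_isBoundaryFourier_tendsto hG hg hpf hχ
  -- Boundedness and decay were obtained for separately chosen limits; uniqueness of limits merges
  -- them.
  obtain rfl : ℓ' = ℓ := funext fun x => tendsto_nhds_unique (hℓ' x) (hℓ x)
  refine ⟨1, one_pos, fun h => ∫ y : ℝ, ψ y * ℓ' (y - h),
    fun h _ => exists_isBoundaryLimit hG hg hpm hχ hone hψ hφψ hℓ h, ?_⟩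
  rw [isLittleO_one_iff]
  have key : Tendsto (fun h => ∫ y : ℝ, ψ y * ℓ' (y - h)) atTop (𝓝 (∫ _ : ℝ, (0 : ℂ))) := by
    refine tendsto_integral_filter_of_dominated_convergence (fun y => ‖ψ y‖ * B)
      (Eventually.of_forall fun h => ?_) (Eventually.of_forall fun h =>
        Eventually.of_forall fun y => ?_)
      (hψ.norm.mul_const B) (Eventually.of_forall fun y => ?_)
    · exact hψ.aestronglyMeasurable.mul ((hℓ.measurable hG hχ).comp
        (measurable_id.sub_const h)).aestronglyMeasurable
    · rw [norm_mul]
      gcongr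
      exact hB _
    · have h1 : Tendsto (fun h : ℝ => y - h) atTop atBot :=
        tendsto_atBot_add_const_left atTop y tendsto_neg_atTop_atBot
      simpa using (hzero.comp h1).const_mul (ψ y)
  simpa using key

end Wiener

end BoundaryBehavior

theorem mainTheorem7 (α : ℝ) (U : TopologicalSpace.Opens ℝ) (G : ℂ → ℂ)
    (hG : AnalyticOnNhd ℂ G {s : ℂ | α < s.re}) :
    (BoundaryBehavior.HasLocalPseudomeasureBoundary G α U →
      ∀ φ ∈ BoundaryBehavior.wienerAlgebraCompact, tsupport φ ⊆ (U : Set ℝ) →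
        BoundaryBehavior.HasPseudomeasureBoundaryWrt G α φ) ∧
    (BoundaryBehavior.HasLocalPseudofunctionBoundary G α U →
      ∀ φ ∈ BoundaryBehavior.wienerAlgebraCompact, tsupport φ ⊆ (U : Set ℝ) →
        BoundaryBehavior.HasPseudofunctionBoundaryWrt G α φ) := by
  exact ⟨fun h _ hφ hs => BoundaryBehavior.hasPseudomeasureBoundaryWrt hG h hφ hs,
    fun h _ hφ hs => BoundaryBehavior.hasPseudofunctionBoundaryWrt hG h hφ hs⟩
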